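/- Let $V:\mathbb R\to\mathbb R$ be continuous with $0<v_0\le V(x)\le v_1$ for a.e. $x\in\mathbb R$, for some constants $v_0,v_1$. Elements of $H^1(\mathbb R)$ and $W^{2,\infty}_{loc}(\mathbb R)$ are identified with their continuous representatives. For $a\in\mathbb R$ put $$K_a=\{u\in H^1(\mathbb R):\ u(a)=\|u\|_{L^\infty(\mathbb R)}=1\},\qquad F(a)=\inf_{u\in K_a}\int_{\mathbb R}\left(|u'(x)|^2+V(x)|u(x)|^2\right)dx .$$ Let $\varphi_\pm\in W^{2,\infty}_{loc}(\mathbb R)$ be the solutions of $$\varphi_\pm''=V\varphi_\pm\ \text{ a.e. in }\mathbb R,\qquad \varphi_\pm(0)=1,\qquad \lim_{x\to\pm\infty}\varphi_\pm(x)=0,$$ and put $h_\pm=\varphi_\pm^2$, $\ell_\pm=\log\varphi_\pm$, $$H_+(x)=\int_{-\infty}^x\frac{d\xi}{h_+(\xi)},\qquad H_-(x)=\int_x^{\infty}\frac{d\xi}{h_-(\xi)}.$$ All these objects are well defined: $\varphi_+$ and $\varphi_-$ exist, are unique and are positive; $F,\ell_+,\ell_-\in C^2(\mathbb R)$; and the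 integrals $H_\pm(x)$ converge for every $x\in\mathbb R$. Moreover, for every $a\in\mathbb R$, each of the following three conditions is equivalent to $$F'(a)=0\quad\text{and}\quad F''(a)\ge 0:$$ 1. $-\ell_+'(a)=\ell_-'(a)\ge\sqrt{V(a)}$; 2. $h_+'(a)H_+(a)=-1$ and $\ell_+''(a)\le 0$; 3. $h_-'(a)H_-(a)=1$ and $\ell_-''(a)\le 0$. -/

import Mathlib

open MeasureTheory Filter Topology Set

noncomputable section

namespace SobolevBest

/-- `g` is a weak (distributional) derivative of `u` on the real line. -/
def HasWeakDeriv (u g : ℝ → ℝ) : Prop :=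
  LocallyIntegrable u ∧ LocallyIntegrable g ∧
    ∀ ψ : ℝ → ℝ, ContDiff ℝ ((⊤ : ℕ∞) : WithTop ℕ∞) ψ → HasCompactSupport ψ →
      ∫ x, u x * deriv ψ x = -∫ x, g x * ψ x

open Classical in
/-- The weak derivative of `u` (it is unique up to null sets); `0` if there is none. -/
def weakDeriv (u : ℝ → ℝ) : ℝ → ℝ :=
  if h : ∃ g, HasWeakDeriv u g then Classical.choose h else 0

/-- `u ∈ H¹(ℝ) = W^{1,2}(ℝ)`, where `u` is the continuous representative. -/
def MemH1 (u : ℝ → ℝ) : Prop :=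
  Continuous u ∧ MemLp u 2 ∧ ∃ g, MemLp g 2 ∧ HasWeakDeriv u g

/-- `I(u; V) = ‖u‖_V² = ∫ (|u'|² + V |u|²) dx`. -/
def energy (V u : ℝ → ℝ) : ℝ :=
  ∫ x, ((weakDeriv u x) ^ 2 + V x * (u x) ^ 2)

/-- `K_a = {u ∈ H¹(ℝ) ; u(a) = ‖u‖_∞ = 1}`. -/
def K (a : ℝ) : Set (ℝ → ℝ) :=
  {u | MemH1 u ∧ u a = 1 ∧ eLpNorm u ⊤ volume = 1}

/-- `F(a) = inf_{u ∈ K_a} I(u; V)`. -/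
def F (V : ℝ → ℝ) (a : ℝ) : ℝ :=
  sInf (energy V '' K a)

/-- `u ∈ L^∞_loc(ℝ)`. -/
def MemLinftyLoc (u : ℝ → ℝ) : Prop :=
  ∀ C : Set ℝ, IsCompact C → MemLp u ⊤ (volume.restrict C)

/-- `φ ∈ W^{2,∞}_loc(ℝ)` (continuous representative), `φ'' = V φ` a.e., `φ(0) = 1`, and
`φ → 0` along the filter `l` (`atTop` for `φ₊`, `atBot` for `φ₋`). -/
def IsDecayingSolution (V : ℝ → ℝ) (l : Filter ℝ) (φ : ℝ → ℝ) : Prop :=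
  Continuous φ ∧ MemLinftyLoc φ ∧
    (∃ φ' φ'' : ℝ → ℝ, MemLinftyLoc φ' ∧ MemLinftyLoc φ'' ∧
      HasWeakDeriv φ φ' ∧ HasWeakDeriv φ' φ'' ∧ ∀ᵐ x, φ'' x = V x * φ x) ∧
    φ 0 = 1 ∧ Tendsto φ l (𝓝 0)

open Classical in
/-- The solution of `φ'' = V φ`, `φ(0) = 1` that decays along `l` (`0` if there is none). -/
def decayingSolution (V : ℝ → ℝ) (l : Filter ℝ) : ℝ → ℝ :=
  if h : ∃ φ, IsDecayingSolution V l φ then Classical.choose h else 0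

/-- `φ₊`, decaying at `+∞`. -/
def phiPlus (V : ℝ → ℝ) : ℝ → ℝ := decayingSolution V atTop

/-- `φ₋`, decaying at `-∞`. -/
def phiMinus (V : ℝ → ℝ) : ℝ → ℝ := decayingSolution V atBot

/-- `h₊ = φ₊²`. -/
def hPlus (V : ℝ → ℝ) (x : ℝ) : ℝ := (phiPlus V x) ^ 2

/-- `h₋ = φ₋²`. -/
def hMinus (V : ℝ → ℝ) (x : ℝ) : ℝ := (phiMinus V x) ^ 2

/-- `ℓ₊ = log φ₊`. -/
def ellPlus (V : ℝ → ℝ) (x : ℝ) : ℝ := Real.log (phiPlus V x)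

/-- `ℓ₋ = log φ₋`. -/
def ellMinus (V : ℝ → ℝ) (x : ℝ) : ℝ := Real.log (phiMinus V x)

/-- `H₊(x) = ∫_{-∞}^x dξ / h₊(ξ)`. -/
def HPlus (V : ℝ → ℝ) (x : ℝ) : ℝ := ∫ ξ in Iic x, 1 / hPlus V ξ

/-- `H₋(x) = ∫_x^∞ dξ / h₋(ξ)`. -/
def HMinus (V : ℝ → ℝ) (x : ℝ) : ℝ := ∫ ξ in Ioi x, 1 / hMinus V ξ

/-- The condition `F'(a) = 0`, `F''(a) ≥ 0`. -/
def LocalMinCondition (V : ℝ → ℝ) (a : ℝ) : Prop :=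
  deriv (F V) a = 0 ∧ 0 ≤ deriv (deriv (F V)) a

/-- All quantities in the criterion are well defined: `φ₊`, `φ₋` exist uniquely and are positive,
`F`, `ℓ₊`, `ℓ₋` are of class `C²`, and the integrals defining `H₊`, `H₋` converge. -/
def WellDefined (V : ℝ → ℝ) : Prop :=
  (∃! φ, IsDecayingSolution V atTop φ) ∧ (∃! φ, IsDecayingSolution V atBot φ) ∧
    (∀ x, 0 < phiPlus V x) ∧ (∀ x, 0 < phiMinus V x) ∧
    ContDiff ℝ 2 (F V) ∧ ContDiff ℝ 2 (ellPlus V) ∧ ContDiff ℝ 2 (ellMinus V) ∧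
    (∀ x, IntegrableOn (fun ξ => 1 / hPlus V ξ) (Iic x)) ∧
    (∀ x, IntegrableOn (fun ξ => 1 / hMinus V ξ) (Ioi x))

end SobolevBest

end

open MeasureTheory Filter Topology Set
open scoped BoundedContinuousFunction

noncomputable section

namespace SobolevBest

/-! Everything is expressed through the logarithmic derivatives `p` of `φ₊` and `q` of `φ₋`. Both
solve the Riccati equation `y' = V - y²`, with `p < 0 < q`.

The key identity is `F = q - p` (`DecayingPair.F_eq`). The infimum is attained by the function equal
to `φ₋/φ₋(a)` left of `a` and to `φ₊/φ₊(a)` right of it (`peak`). Its energy is a pair of boundary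
terms at `a`, because `φ'² + Vφ²` is the derivative of `φφ'`. It is minimal because completing the
square against a solution (`energy_interval_ge`) bounds the energy of any competitor below by
boundary terms.

The Riccati equations then give `F' = p² - q²`, and where `p = -q` they give `F'' = 4q(q² - V)`.
Since `p < 0 < q`, the local condition says `-p = q` and `V ≤ q²`, which is condition 1. As `ℓ₊'' =
V - p²` and `ℓ₋'' = V - q²`, the inequalities in 2 and 3 agree with it. Constancy of the Wronskian
`(q - p)φ₊φ₋` gives explicit `H₊` and `H₋`, with `h₊'H₊ = 2p/(q - p)` and `h₋'H₋ = 2q/(q - p)`, so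
the equalities in 2 and 3 again say `p = -q`.

Existence of `p` and `q` comes from a contraction argument (`exists_riccati`), uniqueness of the
decaying solutions from a Wronskian estimate (`wronskian_nonpos`). -/

/-! ### Primitives and weak derivatives on the line. -/

lemma intervalIntegrable_of_locallyIntegrable {g : ℝ → ℝ} (hg : LocallyIntegrable g) {a b : ℝ} :
    IntervalIntegrable g volume a b :=
  (hg.integrableOn_isCompact isCompact_uIcc).intervalIntegrable

/-- `u` is a primitive of the locally integrable function `g`. -/
def IsPrimitive (u g : ℝ → ℝ) : Prop :=
  LocallyIntegrable g ∧ ∀ x y, ∫ t in x..y, g t = u y - u x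

lemma IsPrimitive.continuous {u g : ℝ → ℝ} (h : IsPrimitive u g) : Continuous u := by
  have : u = fun x => u 0 + ∫ t in (0 : ℝ)..x, g t := by
    ext x; rw [h.2]; ring
  rw [this]
  exact continuous_const.add
    (intervalIntegral.continuous_primitive (fun a b => (intervalIntegrable_of_locallyIntegrable h.1)) 0)

lemma isPrimitive_integral {g : ℝ → ℝ} (hg : LocallyIntegrable g) (c : ℝ) :
    IsPrimitive (fun x => c + ∫ t in (0 : ℝ)..x, g t) g := by
  refine ⟨hg, fun x y => ?_⟩
  rw [add_sub_add_left_eq_sub, intervalIntegral.integral_interval_sub_left] <;>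
  exact (intervalIntegrable_of_locallyIntegrable hg)

lemma isPrimitive_of_hasDerivWithinAt_Ioi {u g : ℝ → ℝ} (hu : Continuous u)
    (hg : LocallyIntegrable g) (h : ∀ x, HasDerivWithinAt u (g x) (Ioi x) x) :
    IsPrimitive u g :=
  ⟨hg, fun _ _ => intervalIntegral.integral_eq_sub_of_hasDeriv_right hu.continuousOn
    (fun t _ => h t) (intervalIntegrable_of_locallyIntegrable hg)⟩

lemma isPrimitive_of_hasDerivAt {u g : ℝ → ℝ} (hg : Continuous g)
    (h : ∀ x, HasDerivAt u (g x) x) : IsPrimitive u g :=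
  isPrimitive_of_hasDerivWithinAt_Ioi
    (continuous_iff_continuousAt.2 fun x => (h x).continuousAt) hg.locallyIntegrable
    fun x => (h x).hasDerivWithinAt

lemma IsPrimitive.hasDerivAt {u g : ℝ → ℝ} (h : IsPrimitive u g) (hg : Continuous g) (x : ℝ) :
    HasDerivAt u (g x) x := by
  have : u = fun x => u 0 + ∫ t in (0 : ℝ)..x, g t := by
    ext x; rw [h.2]; ring
  rw [this]
  exact (hg.integral_hasStrictDerivAt 0 x).hasDerivAt.const_add _

/-- Integration by parts for a `C¹` function and a primitive. -/
lemma IsPrimitive.integral_mul {u g f f' : ℝ → ℝ} (h : IsPrimitive u g)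
    (hf : ∀ x, HasDerivAt f (f' x) x) (hf' : Continuous f') (x y : ℝ) :
    ∫ t in x..y, (f t * g t + f' t * u t) = f y * u y - f x * u x := by
  have hu : u = fun z => u x + ∫ t in x..z, g t := by
    ext z; rw [h.2]; ring
  have hf_eq : f = fun z => f x + ∫ t in x..z, f' t := by
    ext z; rw [(isPrimitive_of_hasDerivAt hf' hf).2]; ring
  have key : ∀ (w k : ℝ → ℝ), LocallyIntegrable k → (w = fun z => w x + ∫ t in x..z, k t) →
      AbsolutelyContinuousOnInterval w x y := by
    intro w k hk hw
    have h1 := IntervalIntegrable.absolutelyContinuousOnInterval_intervalIntegral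
      (intervalIntegrable_of_locallyIntegrable hk (a := x) (b := y)) (c := x) (by simp)
    have h2 : AbsolutelyContinuousOnInterval (fun _ : ℝ => w x) x y :=
      ((LipschitzWith.const (w x)).lipschitzOnWith (s := uIcc x y)).absolutelyContinuousOnInterval
    rw [hw]
    exact h2.add h1
  have uac := key u g h.1 hu
  have fac := key f f' hf'.locallyIntegrable hf_eq
  rw [← fac.integral_deriv_mul_eq_sub uac]
  apply intervalIntegral.integral_congr_ae
  filter_upwards [LocallyIntegrable.ae_hasDerivAt_integral h.1] with t ht _
  have : HasDerivAt u (g t) t := by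
    rw [hu]; exact (ht x).const_add _
  rw [this.deriv, (hf t).deriv]; ring

lemma exists_Ioo_of_hasCompactSupport {ψ : ℝ → ℝ} (h : HasCompactSupport ψ) :
    ∃ R : ℝ, 0 < R ∧ ∀ x, x ∉ Ioo (-R) R → ψ x = 0 := by
  obtain ⟨R, hR⟩ := h.isCompact.isBounded.subset_ball 0
  refine ⟨max R 1, by positivity, fun x hx => ?_⟩
  by_contra hne
  have := hR (subset_tsupport ψ hne)
  rw [Real.ball_eq_Ioo] at this
  apply hx
  have h1 := le_max_left R 1
  constructor <;> [have := this.1; have := this.2] <;> linarith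

lemma integral_eq_intervalIntegral_of_support {k : ℝ → ℝ} {R : ℝ} 
    (h : ∀ x, x ∉ Ioo (-R) R → k x = 0) : ∫ x, k x = ∫ x in (-R)..R, k x := by
  refine (intervalIntegral.integral_eq_integral_of_support_subset fun x hx => ?_).symm
  by_contra hx'
  exact hx (h x fun hx2 => hx' (Ioo_subset_Ioc_self hx2))

lemma IsPrimitive.hasWeakDeriv {u g : ℝ → ℝ} (h : IsPrimitive u g) : HasWeakDeriv u g := by
  refine ⟨h.continuous.locallyIntegrable, h.1, fun ψ hψ hc => ?_⟩
  obtain ⟨R, hR, hz⟩ := exists_Ioo_of_hasCompactSupport hc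
  obtain ⟨R', hR', hz'⟩ := exists_Ioo_of_hasCompactSupport hc.deriv
  have hsub : ∀ x, x ∉ Ioo (-max R R') (max R R') → x ∉ Ioo (-R) R ∧ x ∉ Ioo (-R') R' := by
    intro x hx
    refine ⟨fun h => hx ⟨?_, ?_⟩, fun h => hx ⟨?_, ?_⟩⟩ <;>
    linarith [h.1, h.2, le_max_left R R', le_max_right R R']
  have hder : Continuous (deriv ψ) := hψ.continuous_deriv (by simp)
  have hp := h.integral_mul (f := ψ) (f' := deriv ψ)
    (fun x => (hψ.differentiable (by simp) x).hasDerivAt) hder (-max R R') (max R R')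
  rw [hz _ (hsub _ (by simp)).1, hz _ (hsub _ (by simp)).1] at hp
  rw [intervalIntegral.integral_add] at hp
  · rw [integral_eq_intervalIntegral_of_support (R := max R R'), integral_eq_intervalIntegral_of_support (R := max R R')]
    · have e1 : ∀ x, ψ x * g x = g x * ψ x := fun x => mul_comm _ _
      have e2 : ∀ x, deriv ψ x * u x = u x * deriv ψ x := fun x => mul_comm _ _
      simp only [e1, e2] at hp
      linarith
    · intro x hx; rw [hz x (hsub x hx).1, mul_zero]
    · intro x hx; rw [hz' x (hsub x hx).2, mul_zero]
  · exact (intervalIntegrable_of_locallyIntegrable h.1).continuousOn_mul hψ.continuous.continuousOn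
  · exact (hder.mul h.continuous).intervalIntegrable _ _

lemma integrable_mul_test {u ψ : ℝ → ℝ} (hu : LocallyIntegrable u)
    (hψ : Continuous ψ) (hc : HasCompactSupport ψ) : Integrable (fun x => u x * ψ x) := by
  simpa [smul_eq_mul, mul_comm] using hu.integrable_smul_left_of_hasCompactSupport hψ hc

lemma HasWeakDeriv.ae_eq {u u' g g' : ℝ → ℝ} (h : HasWeakDeriv u g) (h' : HasWeakDeriv u' g')
    (hu : u =ᵐ[volume] u') : g =ᵐ[volume] g' := by
  refine ae_eq_of_integral_contDiff_smul_eq h.2.1 h'.2.1 fun ψ hψ hc => ?_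
  have h1 := h.2.2 ψ hψ hc
  have h2 := h'.2.2 ψ hψ hc
  have h3 : ∫ x, u x * deriv ψ x = ∫ x, u' x * deriv ψ x :=
    integral_congr_ae (by filter_upwards [hu] with x hx; rw [hx])
  simp only [smul_eq_mul, mul_comm (ψ _)]
  linarith

/-- A smooth compactly supported function of zero mean has a smooth compactly supported
primitive. -/
lemma exists_test_primitive {ψ : ℝ → ℝ} (hψ : ContDiff ℝ ((⊤ : ℕ∞) : WithTop ℕ∞) ψ)
    (hc : HasCompactSupport ψ) (h0 : ∫ x, ψ x = 0) :
    ∃ θ : ℝ → ℝ, ContDiff ℝ ((⊤ : ℕ∞) : WithTop ℕ∞) θ ∧ HasCompactSupport θ ∧ deriv θ = ψ := by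
  obtain ⟨R, hR, hz⟩ := exists_Ioo_of_hasCompactSupport hc
  have hint : ∀ a b, IntervalIntegrable ψ volume a b :=
    fun a b => hψ.continuous.intervalIntegrable a b
  have hd : ∀ x, HasDerivAt (fun x => ∫ t in (-R)..x, ψ t) (ψ x) x := fun x =>
    (hψ.continuous.integral_hasStrictDerivAt (-R) x).hasDerivAt
  have hder : deriv (fun x => ∫ t in (-R)..x, ψ t) = ψ := funext fun x => (hd x).deriv
  refine ⟨fun x => ∫ t in (-R)..x, ψ t, ?_, ?_, hder⟩
  -- Since `∞ = ∞ + 1`, smoothness of the primitive reduces to that of its derivative `ψ`.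
  · rw [show (((⊤ : ℕ∞) : WithTop ℕ∞)) = ((⊤ : ℕ∞) : WithTop ℕ∞) + 1 by rfl,
      contDiff_succ_iff_deriv]
    refine ⟨fun x => (hd x).differentiableAt, by simp, ?_⟩
    rw [hder]; exact hψ
  · refine HasCompactSupport.intro (isCompact_Icc (a := -R) (b := R)) fun x hx => ?_
    rw [integral_eq_intervalIntegral_of_support hz] at h0
    have hzero : ∀ a b : ℝ, (∀ t ∈ uIcc a b, t ∉ Ioo (-R) R) → ∫ t in a..b, ψ t = 0 := by
      intro a b hab
      rw [intervalIntegral.integral_congr (g := fun _ => (0 : ℝ)) fun t ht => hz t (hab t ht)]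
      simp
    rcases lt_or_ge x (-R) with h | h
    · apply hzero
      intro t ht
      rw [uIcc_of_ge h.le] at ht
      intro h'; linarith [h'.1, ht.2]
    · have h2 : R < x := by
        by_contra h3; exact hx ⟨h, not_lt.1 h3⟩
      have := hzero R x (by
        intro t ht
        rw [uIcc_of_le h2.le] at ht
        intro h'; linarith [h'.2, ht.1])
      rw [← intervalIntegral.integral_add_adjacent_intervals (hint (-R) R) (hint R x), h0, this,
        add_zero]

/-- **du Bois-Reymond lemma**. -/
lemma HasWeakDeriv.ae_const {v : ℝ → ℝ} (h : HasWeakDeriv v 0) :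
    ∃ c : ℝ, v =ᵐ[volume] fun _ => c := by
  obtain ⟨η, hηs, hηc, hη1⟩ : ∃ η : ℝ → ℝ, ContDiff ℝ ((⊤ : ℕ∞) : WithTop ℕ∞) η ∧
      HasCompactSupport η ∧ ∫ x, η x = 1 := by
    let b : ContDiffBump (0 : ℝ) := ⟨1, 2, by norm_num, by norm_num⟩
    exact ⟨b.normed volume, b.contDiff_normed, b.hasCompactSupport_normed, b.integral_normed⟩
  refine ⟨∫ x, v x * η x, ?_⟩
  refine ae_eq_of_integral_contDiff_smul_eq h.1 (locallyIntegrable_const _) fun ψ hψ hc => ?_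
  set c := ∫ x, ψ x with hcdef
  have hψi : Integrable ψ := hψ.continuous.integrable_of_hasCompactSupport hc
  have hηi : Integrable η := hηs.continuous.integrable_of_hasCompactSupport hηc
  have hcη : HasCompactSupport (fun x => c * η x) := hηc.mul_left
  -- Subtracting `c η` makes the mean zero, so the difference is the derivative of a test function
  -- and `v` integrates to zero against it.
  obtain ⟨θ, hθ, hθc, hθd⟩ := exists_test_primitive (ψ := fun x => ψ x - c * η x)
    (hψ.sub (contDiff_const.mul hηs)) (hc.sub hcη) (by
      rw [integral_sub hψi (hηi.const_mul c), integral_const_mul, hη1, mul_one, sub_self])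
  have key := h.2.2 θ hθ hθc
  rw [hθd] at key
  have i1 := integrable_mul_test h.1 hψ.continuous hc
  have i2 := integrable_mul_test h.1 hηs.continuous hηc
  have e : ∀ x, v x * (ψ x - c * η x) = v x * ψ x - c * (v x * η x) := fun x => by ring
  simp only [e, Pi.zero_apply, zero_mul, integral_zero, neg_zero] at key
  rw [integral_sub i1 (i2.const_mul c), integral_const_mul] at key
  simp only [smul_eq_mul, mul_comm (ψ _)]
  rw [integral_const_mul, ← hcdef]
  linarith

lemma HasWeakDeriv.exists_isPrimitive {u g : ℝ → ℝ} (h : HasWeakDeriv u g) :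
    ∃ w, IsPrimitive w g ∧ u =ᵐ[volume] w := by
  have hw := isPrimitive_integral h.2.1 0
  set w := fun x => (0 : ℝ) + ∫ t in (0 : ℝ)..x, g t
  have hw' := hw.hasWeakDeriv
  have hv : HasWeakDeriv (fun x => u x - w x) 0 := by
    refine ⟨h.1.sub hw'.1, locallyIntegrable_zero, fun ψ hψ hc => ?_⟩
    have hder : Continuous (deriv ψ) := hψ.continuous_deriv (by simp)
    simp only [sub_mul, Pi.zero_apply, zero_mul, integral_zero, neg_zero]
    rw [integral_sub (integrable_mul_test h.1 hder hc.deriv)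
      (integrable_mul_test hw'.1 hder hc.deriv), h.2.2 ψ hψ hc, hw'.2.2 ψ hψ hc,
      sub_self]
  obtain ⟨c, hc⟩ := hv.ae_const
  refine ⟨fun x => c + w x, ⟨h.2.1, fun x y => ?_⟩, ?_⟩
  · rw [hw.2]; ring
  · filter_upwards [hc] with x hx
    simp only [← hx]; ring

lemma HasWeakDeriv.isPrimitive {u g : ℝ → ℝ} (h : HasWeakDeriv u g) (hu : Continuous u) :
    IsPrimitive u g := by
  obtain ⟨w, hw, he⟩ := h.exists_isPrimitive
  rwa [(Continuous.ae_eq_iff_eq _ hu hw.continuous).1 he]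

lemma IsPrimitive.congr_ae {u g g' : ℝ → ℝ} (h : IsPrimitive u g) (hg : LocallyIntegrable g')
    (he : g =ᵐ[volume] g') : IsPrimitive u g' := by
  refine ⟨hg, fun x y => ?_⟩
  rw [← h.2]
  exact intervalIntegral.integral_congr_ae (by filter_upwards [he] with t ht _ using ht.symm)

lemma weakDeriv_spec {u : ℝ → ℝ} (h : ∃ g, HasWeakDeriv u g) : HasWeakDeriv u (weakDeriv u) := by
  unfold weakDeriv
  rw [dif_pos h]
  exact Classical.choose_spec h

/-- Makes the arbitrary choice in `weakDeriv` harmless under integrals. -/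
lemma HasWeakDeriv.weakDeriv_ae_eq {u g : ℝ → ℝ} (h : HasWeakDeriv u g) :
    weakDeriv u =ᵐ[volume] g :=
  (weakDeriv_spec ⟨g, h⟩).ae_eq h (ae_eq_refl u)

lemma memLinftyLoc_of_continuous {u : ℝ → ℝ} (hu : Continuous u) : MemLinftyLoc u := by
  intro C hC
  obtain ⟨B, hB⟩ := hC.exists_bound_of_continuousOn hu.continuousOn
  exact memLp_top_of_bound hu.aestronglyMeasurable B
    ((ae_restrict_iff' hC.measurableSet).2 (Eventually.of_forall hB))

/-! ### Global bounded solutions of the Riccati equation. -/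

/-- The bounded solution of `w' = g - k w`. -/
def expConv (k : ℝ) (g : ℝ → ℝ) (x : ℝ) : ℝ :=
  Real.exp (-(k * x)) * ∫ y in Iic x, Real.exp (k * y) * g y

lemma integrableOn_exp_mul {k : ℝ} (hk : 0 < k) {g : ℝ → ℝ} (hg : Continuous g) {B : ℝ}
    (hB : ∀ x, |g x| ≤ B) (x : ℝ) : IntegrableOn (fun y => Real.exp (k * y) * g y) (Iic x) :=
  (integrableOn_exp_mul_Iic hk x).mul_bdd hg.aestronglyMeasurable.restrict
    (Eventually.of_forall hB)

lemma expConv_const {k : ℝ} (hk : 0 < k) (c x : ℝ) : expConv k (fun _ => c) x = c / k := by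
  unfold expConv
  rw [integral_mul_const, integral_exp_mul_Iic hk, Real.exp_neg]
  have := Real.exp_pos (k * x)
  field_simp

lemma expConv_mono {k : ℝ} (hk : 0 < k) {g g' : ℝ → ℝ} (hg : Continuous g) (hg' : Continuous g')
    {B B' : ℝ} (hB : ∀ x, |g x| ≤ B) (hB' : ∀ x, |g' x| ≤ B') (h : ∀ x, g x ≤ g' x) (x : ℝ) :
    expConv k g x ≤ expConv k g' x := by
  refine mul_le_mul_of_nonneg_left ?_ (Real.exp_pos _).le
  exact setIntegral_mono (integrableOn_exp_mul hk hg hB x) (integrableOn_exp_mul hk hg' hB' x)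
    fun y => mul_le_mul_of_nonneg_left (h y) (Real.exp_pos _).le

lemma expConv_sub {k : ℝ} (hk : 0 < k) {g g' : ℝ → ℝ} (hg : Continuous g) (hg' : Continuous g')
    {B B' : ℝ} (hB : ∀ x, |g x| ≤ B) (hB' : ∀ x, |g' x| ≤ B') (x : ℝ) :
    expConv k (fun y => g y - g' y) x = expConv k g x - expConv k g' x := by
  unfold expConv
  simp only [mul_sub]
  rw [integral_sub (integrableOn_exp_mul hk hg hB x) (integrableOn_exp_mul hk hg' hB' x), mul_sub]

lemma hasDerivAt_expConv {k : ℝ} (hk : 0 < k) {g : ℝ → ℝ} (hg : Continuous g) {B : ℝ}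
    (hB : ∀ x, |g x| ≤ B) (x : ℝ) :
    HasDerivAt (expConv k g) (g x - k * expConv k g x) x := by
  set f : ℝ → ℝ := fun y => Real.exp (k * y) * g y with hf
  have hfc : Continuous f := by fun_prop
  have hi := integrableOn_exp_mul hk hg hB
  have he : (fun x => ∫ y in Iic x, f y) =
      fun x => (∫ y in Iic (0 : ℝ), f y) + ∫ y in (0 : ℝ)..x, f y := by
    ext z
    rw [← intervalIntegral.integral_Iic_sub_Iic (hi 0) (hi z)]; ring
  have h1 : HasDerivAt (fun x => ∫ y in Iic x, f y) (f x) x := by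
    rw [he]
    exact (hfc.integral_hasStrictDerivAt 0 x).hasDerivAt.const_add _
  have h2 : HasDerivAt (fun x => Real.exp (-(k * x))) (Real.exp (-(k * x)) * -(k * 1)) x :=
    (((hasDerivAt_id x).const_mul k).neg).exp
  have h3 := h2.mul h1
  refine h3.congr_deriv ?_
  have : Real.exp (-(k * x)) * Real.exp (k * x) = 1 := by
    rw [← Real.exp_add]; simp
  simp only [hf, expConv]
  linear_combination (g x) * this

/-- The Riccati equation `q' = V - q²` has a global solution with values in `[m, M]` if
`m² ≤ V ≤ M²`. -/
lemma exists_riccati {V : ℝ → ℝ} (hV : Continuous V) {m M : ℝ} (hm : 0 < m)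
    (hmV : ∀ x, m ^ 2 ≤ V x) (hVM : ∀ x, V x ≤ M ^ 2) (hM : 0 < M) :
    ∃ q : ℝ → ℝ, (∀ x, HasDerivAt q (V x - q x ^ 2) x) ∧ ∀ x, m ≤ q x ∧ q x ≤ M := by
  have hmM : m ≤ M := by
    have := (hmV 0).trans (hVM 0)
    exact le_of_sq_le_sq this hM.le
  -- Write the equation as `q' = (V + kq - q²) - kq`. With `k = 2M` the map `c ↦ kc - c²` is
  -- nondecreasing on `[m, M]`, so the bracket stays in `[km, kM]` and `expConv k` sends it back
  -- into `[m, M]`.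
  set k := 2 * M with hk
  have hk0 : 0 < k := by positivity
  -- Truncation to `[m, M]` lets the fixed-point map act on all bounded continuous functions; the
  -- fixed point takes values in `[m, M]`, where truncation does nothing.
  set cl : ℝ → ℝ := fun c => max m (min M c) with hcl
  have hclc : Continuous cl := by fun_prop
  have cl1 : ∀ c, m ≤ cl c := fun c => le_max_left _ _
  have cl2 : ∀ c, cl c ≤ M := fun c => max_le hmM (min_le_left _ _)
  have cl3 : ∀ c, m ≤ c → c ≤ M → cl c = c := fun c h1 h2 => by
    simp [hcl, min_eq_right h2, max_eq_right h1]
  have cl4 : ∀ c d, |cl c - cl d| ≤ |c - d| := fun c d =>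
    (abs_max_sub_max_le_max m (min M c) m (min M d)).trans <| by
      simpa using abs_min_sub_min_le_max M c M d
  set G : (ℝ → ℝ) → ℝ → ℝ := fun q x => V x + k * cl (q x) - cl (q x) ^ 2 with hG
  have G1 : ∀ q x, k * m ≤ G q x := fun q x => by
    simp only [hG, hk]; nlinarith [cl1 (q x), cl2 (q x), hmV x]
  have G2 : ∀ q x, G q x ≤ k * M := fun q x => by
    simp only [hG, hk]; nlinarith [cl1 (q x), cl2 (q x), hVM x]
  have G3 : ∀ q x, |G q x| ≤ k * M := fun q x =>
    abs_le.2 ⟨by have := G1 q x; have := mul_pos hk0 hm; have := mul_pos hk0 hM; linarith, G2 q x⟩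
  have G4 : ∀ q, Continuous q → Continuous (G q) := fun q hq => by
    simp only [hG]; fun_prop
  have G5 : ∀ q q' x, |G q x - G q' x| ≤ (k - 2 * m) * |q x - q' x| := fun q q' x => by
    have e : G q x - G q' x = (k - cl (q x) - cl (q' x)) * (cl (q x) - cl (q' x)) := by
      simp only [hG]; ring
    rw [e, abs_mul]
    have := cl1 (q x); have := cl2 (q x); have := cl1 (q' x); have := cl2 (q' x)
    refine mul_le_mul ?_ (cl4 _ _) (abs_nonneg _) (by linarith)
    rw [abs_of_nonneg] <;> linarith
  have hcm : ∀ c : ℝ, k * c / k = c := fun c => by field_simp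
  have T1 : ∀ q, Continuous q → ∀ x, m ≤ expConv k (G q) x := fun q hq x => by
    have := expConv_mono hk0 (continuous_const (y := k * m)) (G4 q hq) (fun _ => le_rfl) (G3 q)
      (G1 q) x
    rwa [expConv_const hk0, hcm] at this
  have T2 : ∀ q, Continuous q → ∀ x, expConv k (G q) x ≤ M := fun q hq x => by
    have := expConv_mono hk0 (G4 q hq) (continuous_const (y := k * M)) (G3 q) (fun _ => le_rfl)
      (G2 q) x
    rwa [expConv_const hk0, hcm] at this
  have T3 : ∀ q, Continuous q → Continuous (expConv k (G q)) := fun q hq =>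
    continuous_iff_continuousAt.2 fun x => (hasDerivAt_expConv hk0 (G4 q hq) (G3 q) x).continuousAt
  let T : (ℝ →ᵇ ℝ) → (ℝ →ᵇ ℝ) := fun q =>
    BoundedContinuousFunction.ofNormedAddCommGroup (expConv k (G q)) (T3 q q.continuous) M
      fun x => by
        rw [Real.norm_eq_abs, abs_of_nonneg (hm.le.trans (T1 q q.continuous x))]
        exact T2 q q.continuous x
  have hTapp : ∀ q x, T q x = expConv k (G q) x := fun q x => rfl
  obtain ⟨K, hK⟩ : ∃ K : NNReal, (K : ℝ) = (k - 2 * m) / k :=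
    ⟨Real.toNNReal _, Real.coe_toNNReal _ (div_nonneg (by linarith) hk0.le)⟩
  -- The bracket is Lipschitz in `q` with constant `k - 2m`, and `expConv k` gains a factor `1/k`;
  -- the ratio is `1 - m/M < 1`.
  have hT : ContractingWith K T := by
    refine ⟨?_, LipschitzWith.of_dist_le_mul fun q q' => ?_⟩
    · rw [← NNReal.coe_lt_coe]
      rw [hK, NNReal.coe_one, div_lt_one hk0]; linarith
    · rw [BoundedContinuousFunction.dist_le (by positivity)]
      intro x
      rw [hTapp, hTapp, Real.dist_eq,
        ← expConv_sub hk0 (G4 q q.continuous) (G4 q' q'.continuous) (G3 q) (G3 q')]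
      set D := (k - 2 * m) * dist q q' with hD
      have hD' : ∀ y, |G q y - G q' y| ≤ D := fun y =>
        (G5 q q' y).trans (mul_le_mul_of_nonneg_left
          (by rw [← Real.dist_eq]; exact q.dist_coe_le_dist y) (by linarith))
      have hc : Continuous fun y => G q y - G q' y :=
        (G4 q q.continuous).sub (G4 q' q'.continuous)
      have u := expConv_mono hk0 hc (continuous_const (y := D)) hD' (fun _ => le_rfl)
        (fun y => (abs_le.1 (hD' y)).2) x
      have l := expConv_mono hk0 (continuous_const (y := -D)) hc (fun _ => le_rfl) hD'
        (fun y => (abs_le.1 (hD' y)).1) x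
      rw [expConv_const hk0] at u l
      have : (K : ℝ) * dist q q' = D / k := by
        rw [hK, hD]; ring
      rw [this, abs_le, ← neg_div]
      exact ⟨l, u⟩
  obtain ⟨q, hq, -⟩ := hT.exists_fixedPoint 0 (edist_ne_top _ _)
  have hqe : ∀ x, q x = expConv k (G q) x := fun x => by
    rw [← hTapp, hq.eq]
  have hq1 : ∀ x, m ≤ q x := fun x => by rw [hqe]; exact T1 q q.continuous x
  have hq2 : ∀ x, q x ≤ M := fun x => by rw [hqe]; exact T2 q q.continuous x
  refine ⟨q, fun x => ?_, fun x => ⟨hq1 x, hq2 x⟩⟩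
  have hd := hasDerivAt_expConv hk0 (G4 q q.continuous) (G3 q) x
  rw [← funext hqe] at hd
  refine hd.congr_deriv ?_
  simp only [hG, cl3 _ (hq1 x) (hq2 x)]
  ring

/-- The Riccati equation is invariant under `q(x) ↦ -q(-x)` combined with reflection of `V`. -/
lemma exists_riccati_neg {V : ℝ → ℝ} (hV : Continuous V) {m M : ℝ} (hm : 0 < m)
    (hmV : ∀ x, m ^ 2 ≤ V x) (hVM : ∀ x, V x ≤ M ^ 2) (hM : 0 < M) :
    ∃ p : ℝ → ℝ, (∀ x, HasDerivAt p (V x - p x ^ 2) x) ∧ ∀ x, -M ≤ p x ∧ p x ≤ -m := by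
  obtain ⟨q, hq, hb⟩ := exists_riccati (V := fun x => V (-x)) (by fun_prop) hm
    (fun x => hmV (-x)) (fun x => hVM (-x)) hM
  refine ⟨fun x => -q (-x), fun x => ?_, fun x => ?_⟩
  · refine ((hq (-x)).comp x (hasDerivAt_neg x)).neg.congr_deriv ?_
    rw [neg_neg]; ring
  · have := hb (-x); constructor <;> linarith

/-! ### Decaying solutions: existence, regularity and uniqueness. -/

/-- A positive function with logarithmic derivative `p`, normalised at `0`. -/
lemma exists_logDeriv {p : ℝ → ℝ} (hp : Continuous p) :
    ∃ φ : ℝ → ℝ, (∀ x, HasDerivAt φ (p x * φ x) x) ∧ (∀ x, 0 < φ x) ∧ φ 0 = 1 := by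
  refine ⟨fun x => Real.exp (∫ t in (0 : ℝ)..x, p t), fun x => ?_, fun x => Real.exp_pos _,
    by simp⟩
  rw [mul_comm]
  exact (hp.integral_hasStrictDerivAt 0 x).hasDerivAt.exp

/-- The product `φ(x) e^{mx}` is nonincreasing, so the decay is exponential. -/
lemma tendsto_atTop_zero_of_logDeriv_le {p φ : ℝ → ℝ} {m : ℝ} (hm : 0 < m)
    (hφ : ∀ x, HasDerivAt φ (p x * φ x) x) (hpos : ∀ x, 0 < φ x) (hp : ∀ x, p x ≤ -m) :
    Tendsto φ atTop (𝓝 0) := by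
  have hd : ∀ x, HasDerivAt (fun x => φ x * Real.exp (m * x))
      ((p x + m) * (φ x * Real.exp (m * x))) x := fun x => by
    refine ((hφ x).mul ((hasDerivAt_id x).const_mul m).exp).congr_deriv ?_
    simp only [id]; ring
  have hanti : Antitone fun x => φ x * Real.exp (m * x) :=
    antitone_of_deriv_nonpos (fun x => (hd x).differentiableAt) fun x => by
      rw [(hd x).deriv]
      exact mul_nonpos_of_nonpos_of_nonneg (by linarith [hp x])
        (mul_pos (hpos x) (Real.exp_pos _)).le
  have hb : ∀ᶠ x in atTop, φ x ≤ φ 0 * Real.exp (-(m * x)) := by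
    filter_upwards [eventually_ge_atTop 0] with x hx
    have := hanti hx
    simp only [mul_zero, Real.exp_zero, mul_one] at this
    rw [Real.exp_neg, ← div_eq_mul_inv, le_div_iff₀ (Real.exp_pos _)]
    exact this
  refine squeeze_zero' (Eventually.of_forall fun x => (hpos x).le) hb ?_
  have h1 : Tendsto (fun x : ℝ => Real.exp (-(m * x))) atTop (𝓝 0) :=
    Real.tendsto_exp_neg_atTop_nhds_zero.comp (tendsto_id.const_mul_atTop hm)
  simpa using h1.const_mul (φ 0)

lemma tendsto_atBot_zero_of_le_logDeriv {q ψ : ℝ → ℝ} {m : ℝ} (hm : 0 < m)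
    (hψ : ∀ x, HasDerivAt ψ (q x * ψ x) x) (hpos : ∀ x, 0 < ψ x) (hq : ∀ x, m ≤ q x) :
    Tendsto ψ atBot (𝓝 0) := by
  have := tendsto_atTop_zero_of_logDeriv_le (p := fun x => -q (-x)) (φ := fun x => ψ (-x)) hm
    (fun x => ((hψ (-x)).comp x (hasDerivAt_neg x)).congr_deriv (by ring))
    (fun x => hpos _) (fun x => by linarith [hq (-x)])
  simpa [Function.comp_def] using this.comp tendsto_neg_atBot_atTop

/-- `χ` is a classical solution of `χ'' = V χ`, with derivative `d`. -/
def IsClassicalSolution (V χ d : ℝ → ℝ) : Prop :=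
  (∀ x, HasDerivAt χ (d x) x) ∧ ∀ x, HasDerivAt d (V x * χ x) x

lemma IsClassicalSolution.neg {V χ d : ℝ → ℝ} (h : IsClassicalSolution V χ d) :
    IsClassicalSolution V (fun x => -χ x) (fun x => -d x) :=
  ⟨fun x => (h.1 x).neg, fun x => (h.2 x).neg.congr_deriv (by ring)⟩

lemma IsClassicalSolution.comp_neg {V χ d : ℝ → ℝ} (h : IsClassicalSolution V χ d) :
    IsClassicalSolution (fun x => V (-x)) (fun x => χ (-x)) (fun x => -d (-x)) :=
  ⟨fun x => ((h.1 (-x)).comp x (hasDerivAt_neg x)).congr_deriv (by ring),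
    fun x => ((h.2 (-x)).comp x (hasDerivAt_neg x)).neg.congr_deriv (by ring)⟩

lemma isClassicalSolution_of_logDeriv {V p φ : ℝ → ℝ}
    (hp : ∀ x, HasDerivAt p (V x - p x ^ 2) x) (hφ : ∀ x, HasDerivAt φ (p x * φ x) x) :
    IsClassicalSolution V φ (fun x => p x * φ x) :=
  ⟨hφ, fun x => ((hp x).mul (hφ x)).congr_deriv (by ring)⟩

/-- As `V χ` is continuous, the first weak derivative agrees a.e. with a `C¹` function `d`, which is
then the genuine derivative of `χ`. -/
lemma IsDecayingSolution.exists_isClassicalSolution {V : ℝ → ℝ} (hV : Continuous V) {l : Filter ℝ}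
    {χ : ℝ → ℝ} (h : IsDecayingSolution V l χ) : ∃ d, IsClassicalSolution V χ d := by
  obtain ⟨hc, -, ⟨χ', χ'', -, -, h1, h2, h3⟩, -⟩ := h
  have hVχ : Continuous fun x => V x * χ x := hV.mul hc
  obtain ⟨d, hd, hde⟩ := h2.exists_isPrimitive
  have hd' := hd.congr_ae hVχ.locallyIntegrable h3
  have hχ := (h1.isPrimitive hc).congr_ae hd.continuous.locallyIntegrable hde
  exact ⟨d, hχ.hasDerivAt hd.continuous, hd'.hasDerivAt hVχ⟩

lemma IsClassicalSolution.continuous {V χ d : ℝ → ℝ} (h : IsClassicalSolution V χ d) :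
    Continuous χ ∧ Continuous d :=
  ⟨continuous_iff_continuousAt.2 fun x => (h.1 x).continuousAt,
    continuous_iff_continuousAt.2 fun x => (h.2 x).continuousAt⟩

lemma IsClassicalSolution.isDecayingSolution {V χ d : ℝ → ℝ} (hV : Continuous V) {l : Filter ℝ}
    (h : IsClassicalSolution V χ d) (h0 : χ 0 = 1) (hl : Tendsto χ l (𝓝 0)) :
    IsDecayingSolution V l χ := by
  have hVχ : Continuous fun x => V x * χ x := hV.mul h.continuous.1
  exact ⟨h.continuous.1, memLinftyLoc_of_continuous h.continuous.1,
    ⟨d, fun x => V x * χ x, memLinftyLoc_of_continuous h.continuous.2,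
      memLinftyLoc_of_continuous hVχ,
      (isPrimitive_of_hasDerivAt h.continuous.2 h.1).hasWeakDeriv,
      (isPrimitive_of_hasDerivAt hVχ h.2).hasWeakDeriv, Eventually.of_forall fun _ => rfl⟩, h0, hl⟩

lemma eq_of_hasDerivAt_zero {f : ℝ → ℝ} (hf : ∀ x, HasDerivAt f 0 x) (x y : ℝ) : f x = f y :=
  is_const_of_deriv_eq_zero (fun x => (hf x).differentiableAt) (fun x => (hf x).deriv) x y

/-- The Wronskian of two solutions is constant. -/
lemma wronskian_eq {V χ d φ e : ℝ → ℝ} (h : IsClassicalSolution V χ d)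
    (h' : IsClassicalSolution V φ e) (x y : ℝ) :
    d x * φ x - χ x * e x = d y * φ y - χ y * e y :=
  eq_of_hasDerivAt_zero (f := fun x => d x * φ x - χ x * e x) (fun x =>
    (((h.2 x).mul (h'.1 x)).sub ((h.1 x).mul (h'.2 x))).congr_deriv (by ring)) x y

/-- Only `χ → 0` is known, with no control of `d` at infinity, so the limit of the Wronskian cannot
be read off directly. Instead, a positive Wronskian would keep `χ φ` away from zero at `+∞`. -/
lemma wronskian_nonpos {V p φ χ d : ℝ → ℝ} {M : ℝ} (hM : 0 < M)
    (hp : ∀ x, HasDerivAt p (V x - p x ^ 2) x) (hφ : ∀ x, HasDerivAt φ (p x * φ x) x)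
    (hpos : ∀ x, 0 < φ x) (hpM : ∀ x, -M ≤ p x) (hφl : Tendsto φ atTop (𝓝 0))
    (h : IsClassicalSolution V χ d) (hl : Tendsto χ atTop (𝓝 0)) :
    d 0 * φ 0 - χ 0 * (p 0 * φ 0) ≤ 0 := by
  set W := d 0 * φ 0 - χ 0 * (p 0 * φ 0) with hWdef
  have hW : ∀ x, d x * φ x - χ x * (p x * φ x) = W := fun x =>
    wronskian_eq h (isClassicalSolution_of_logDeriv hp hφ) x 0
  by_contra! hW0
  -- Here `(χ/φ)' = W/φ²` and `(1/φ²)' = -2p/φ²`. Since `p ≥ -M`, this is the `c` for which `χ/φ -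
  -- c/φ²` is monotone; multiplying by `φ²` gives `χφ ≥ c + kφ²`, whose right side tends to `c > 0`.
  set c := W / (2 * M) with hc
  have hc0 : 0 < c := by positivity
  have hcM : 2 * c * M = W := by rw [hc]; field_simp
  have hd : ∀ x, HasDerivAt (fun x => χ x / φ x - c / φ x ^ 2)
      ((W + 2 * c * p x) / φ x ^ 2) x := fun x => by
    have hne := (hpos x).ne'
    refine (((h.1 x).div (hφ x) hne).sub
      ((hasDerivAt_const x c).div ((hφ x).pow 2) (pow_ne_zero 2 hne))).congr_deriv ?_
    rw [← hW x]
    simp only [Pi.pow_apply]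
    field_simp
    ring
  have hmono : Monotone fun x => χ x / φ x - c / φ x ^ 2 :=
    monotone_of_deriv_nonneg (fun x => (hd x).differentiableAt) fun x => by
      rw [(hd x).deriv]
      refine div_nonneg ?_ (sq_nonneg _)
      have := mul_le_mul_of_nonneg_left (hpM x) (by positivity : 0 ≤ 2 * c)
      linarith
  set k := χ 0 / φ 0 - c / φ 0 ^ 2
  have hev : ∀ᶠ x in atTop, c + k * φ x ^ 2 ≤ χ x * φ x := by
    filter_upwards [eventually_ge_atTop 0] with x hx
    have h1 : k ≤ χ x / φ x - c / φ x ^ 2 := hmono hx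
    have h2 := mul_le_mul_of_nonneg_right h1 (sq_nonneg (φ x))
    have hne := (hpos x).ne'
    have h3 : (χ x / φ x - c / φ x ^ 2) * φ x ^ 2 = χ x * φ x - c := by field_simp
    linarith
  have l1 : Tendsto (fun x => c + k * φ x ^ 2) atTop (𝓝 (c + k * 0 ^ 2)) :=
    ((hφl.pow 2).const_mul k).const_add c
  have := le_of_tendsto_of_tendsto l1 (hl.mul hφl) hev
  simp at this
  linarith

/-- Applying `wronskian_nonpos` to `χ` and `-χ` makes the Wronskian vanish, so `χ/φ` is constant. -/
lemma eq_of_tendsto_atTop {V p φ χ d : ℝ → ℝ} {M : ℝ} (hM : 0 < M)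
    (hp : ∀ x, HasDerivAt p (V x - p x ^ 2) x) (hφ : ∀ x, HasDerivAt φ (p x * φ x) x)
    (hpos : ∀ x, 0 < φ x) (hpM : ∀ x, -M ≤ p x) (hφl : Tendsto φ atTop (𝓝 0))
    (h : IsClassicalSolution V χ d) (hl : Tendsto χ atTop (𝓝 0)) (h0 : χ 0 = φ 0) :
    χ = φ := by
  have w1 := wronskian_nonpos hM hp hφ hpos hpM hφl h hl
  have w2 := wronskian_nonpos hM hp hφ hpos hpM hφl h.neg (by simpa using hl.neg)
  have hW : ∀ x, d x * φ x - χ x * (p x * φ x) = 0 := fun x => by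
    rw [wronskian_eq h (isClassicalSolution_of_logDeriv hp hφ) x 0]
    linarith
  have hconst : ∀ x y, χ x / φ x = χ y / φ y := eq_of_hasDerivAt_zero fun x =>
    ((h.1 x).div (hφ x) (hpos x).ne').congr_deriv (by rw [hW x, zero_div])
  ext x
  have := hconst x 0
  rw [h0, div_self (hpos 0).ne'] at this
  exact (div_eq_one_iff_eq (hpos x).ne').1 this

lemma eq_of_tendsto_atBot {V q ψ χ d : ℝ → ℝ} {M : ℝ} (hM : 0 < M)
    (hq : ∀ x, HasDerivAt q (V x - q x ^ 2) x) (hψ : ∀ x, HasDerivAt ψ (q x * ψ x) x)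
    (hpos : ∀ x, 0 < ψ x) (hqM : ∀ x, q x ≤ M) (hψl : Tendsto ψ atBot (𝓝 0))
    (h : IsClassicalSolution V χ d) (hl : Tendsto χ atBot (𝓝 0)) (h0 : χ 0 = ψ 0) :
    χ = ψ := by
  have key := eq_of_tendsto_atTop (V := fun x => V (-x)) (p := fun x => -q (-x))
    (φ := fun x => ψ (-x)) hM
    (fun x => ((hq (-x)).comp x (hasDerivAt_neg x)).neg.congr_deriv (by ring))
    (fun x => ((hψ (-x)).comp x (hasDerivAt_neg x)).congr_deriv (by ring))
    (fun x => hpos _) (fun x => by linarith [hqM (-x)]) (hψl.comp tendsto_neg_atTop_atBot)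
    h.comp_neg (hl.comp tendsto_neg_atTop_atBot) (by simpa using h0)
  ext x
  simpa using congrFun key (-x)

lemma decayingSolution_eq {V : ℝ → ℝ} {l : Filter ℝ} {φ : ℝ → ℝ} (h : IsDecayingSolution V l φ)
    (hu : ∀ χ, IsDecayingSolution V l χ → χ = φ) : decayingSolution V l = φ := by
  have hex : ∃ φ, IsDecayingSolution V l φ := ⟨φ, h⟩
  unfold decayingSolution
  rw [dif_pos hex]
  exact hu _ (Classical.choose_spec hex)

/-! ### Energy of solutions on half-lines and comparison with competitors. -/

lemma integrableOn_Iic_deriv_of_nonneg {f f' : ℝ → ℝ} {l : ℝ} (hf : ∀ x, HasDerivAt f (f' x) x)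
    (h0 : ∀ x, 0 ≤ f' x) (hl : Tendsto f atBot (𝓝 l)) (a : ℝ) : IntegrableOn f' (Iic a) := by
  have h := integrableOn_Ioi_deriv_of_nonneg' (a := -a) (g := fun x => -f (-x))
    (g' := fun x => f' (-x))
    (fun x _ => ((hf (-x)).comp x (hasDerivAt_neg x)).neg.congr_deriv (by ring))
    (fun x _ => h0 _) (hl.comp tendsto_neg_atTop_atBot).neg
  have h2 := (Measure.measurePreserving_neg (volume : Measure ℝ)).integrableOn_comp_preimage
    (Homeomorph.neg ℝ).measurableEmbedding (f := f') (s := Iio a)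
  rw [integrableOn_Iic_iff_integrableOn_Iio, ← h2]
  simpa [Function.comp_def] using h

section

variable {V p q φ ψ : ℝ → ℝ} {M a : ℝ}

lemma hasDerivAt_logDeriv_mul_sq (hp : ∀ x, HasDerivAt p (V x - p x ^ 2) x)
    (hφ : ∀ x, HasDerivAt φ (p x * φ x) x) (x : ℝ) :
    HasDerivAt (fun x => p x * φ x * φ x) ((p x * φ x) ^ 2 + V x * φ x ^ 2) x :=
  (((isClassicalSolution_of_logDeriv hp hφ).2 x).mul (hφ x)).congr_deriv (by ring)

lemma tendsto_bdd_mul_zero {l : Filter ℝ} {b f : ℝ → ℝ} {B : ℝ} (hb : ∀ x, |b x| ≤ B)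
    (hf : Tendsto f l (𝓝 0)) : Tendsto (fun x => b x * f x) l (𝓝 0) := by
  refine squeeze_zero_norm (a := fun x => B * |f x|) (fun x => ?_) (by simpa using hf.abs.const_mul B)
  rw [Real.norm_eq_abs, abs_mul]
  exact mul_le_mul_of_nonneg_right (hb x) (abs_nonneg _)

/-- The integrand is the derivative of `φφ'`, which tends to zero; being nonnegative it is
integrable. -/
lemma energy_Ioi (hp : ∀ x, HasDerivAt p (V x - p x ^ 2) x)
    (hφ : ∀ x, HasDerivAt φ (p x * φ x) x) (hpM : ∀ x, |p x| ≤ M) (hV0 : ∀ x, 0 ≤ V x)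
    (hl : Tendsto φ atTop (𝓝 0)) (a : ℝ) :
    IntegrableOn (fun x => (p x * φ x) ^ 2 + V x * φ x ^ 2) (Ioi a) ∧
      ∫ x in Ioi a, ((p x * φ x) ^ 2 + V x * φ x ^ 2) = -(p a * φ a * φ a) := by
  have hd := hasDerivAt_logDeriv_mul_sq hp hφ
  have h0 : ∀ x, 0 ≤ (p x * φ x) ^ 2 + V x * φ x ^ 2 := fun x =>
    add_nonneg (sq_nonneg _) (mul_nonneg (hV0 x) (sq_nonneg _))
  have ht : Tendsto (fun x => p x * φ x * φ x) atTop (𝓝 0) := by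
    simpa using (tendsto_bdd_mul_zero hpM hl).mul hl
  have hi := integrableOn_Ioi_deriv_of_nonneg' (a := a) (fun x _ => hd x) (fun x _ => h0 x) ht
  exact ⟨hi, by rw [integral_Ioi_of_hasDerivAt_of_tendsto' (fun x _ => hd x) hi ht, zero_sub]⟩

lemma energy_Iic (hq : ∀ x, HasDerivAt q (V x - q x ^ 2) x)
    (hψ : ∀ x, HasDerivAt ψ (q x * ψ x) x) (hqM : ∀ x, |q x| ≤ M) (hV0 : ∀ x, 0 ≤ V x)
    (hl : Tendsto ψ atBot (𝓝 0)) (a : ℝ) :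
    IntegrableOn (fun x => (q x * ψ x) ^ 2 + V x * ψ x ^ 2) (Iic a) ∧
      ∫ x in Iic a, ((q x * ψ x) ^ 2 + V x * ψ x ^ 2) = q a * ψ a * ψ a := by
  have hd := hasDerivAt_logDeriv_mul_sq hq hψ
  have h0 : ∀ x, 0 ≤ (q x * ψ x) ^ 2 + V x * ψ x ^ 2 := fun x =>
    add_nonneg (sq_nonneg _) (mul_nonneg (hV0 x) (sq_nonneg _))
  have ht : Tendsto (fun x => q x * ψ x * ψ x) atBot (𝓝 0) := by
    simpa using (tendsto_bdd_mul_zero hqM hl).mul hl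
  have hi := integrableOn_Iic_deriv_of_nonneg hd h0 ht a
  exact ⟨hi, by rw [integral_Iic_of_hasDerivAt_of_tendsto' (fun x _ => hd x) hi ht, sub_zero]⟩

/-- Lower bound for the energy on an interval by comparison with a solution. -/
lemma energy_interval_ge (hV : Continuous V) (hV0 : ∀ x, 0 ≤ V x)
    (hp : ∀ x, HasDerivAt p (V x - p x ^ 2) x)
    (hφ : ∀ x, HasDerivAt φ (p x * φ x) x) {u g : ℝ → ℝ} (hu : IsPrimitive u g)
    (hg2 : Integrable fun x => g x ^ 2) {x y : ℝ} (hxy : x ≤ y) :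
    2 * (p y * φ y * u y - p x * φ x * u x) - (p y * φ y * φ y - p x * φ x * φ x) ≤
      ∫ t in x..y, (g t ^ 2 + V t * u t ^ 2) := by
  have hs := isClassicalSolution_of_logDeriv hp hφ
  obtain ⟨cφ, cd⟩ := hs.continuous
  have cu := hu.continuous
  have e1 := hu.integral_mul hs.2 (hV.mul cφ) x y
  have e2 := intervalIntegral.integral_eq_sub_of_hasDerivAt (a := x) (b := y)
    (fun t _ => hasDerivAt_logDeriv_mul_sq hp hφ t)
    ((by fun_prop : Continuous fun t => (p t * φ t) ^ 2 + V t * φ t ^ 2).intervalIntegrable _ _)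
  have i1 : IntervalIntegrable (fun t => p t * φ t * g t + V t * φ t * u t) volume x y :=
    ((intervalIntegrable_of_locallyIntegrable hu.1).continuousOn_mul cd.continuousOn).add
      ((by fun_prop : Continuous fun t => V t * φ t * u t).intervalIntegrable _ _)
  have i2 : IntervalIntegrable (fun t => (p t * φ t) ^ 2 + V t * φ t ^ 2) volume x y :=
    (by fun_prop : Continuous fun t => (p t * φ t) ^ 2 + V t * φ t ^ 2).intervalIntegrable _ _
  have i3 : IntervalIntegrable (fun t => g t ^ 2 + V t * u t ^ 2) volume x y :=
    hg2.intervalIntegrable.add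
      ((by fun_prop : Continuous fun t => V t * u t ^ 2).intervalIntegrable _ _)
  rw [← e1, ← e2, ← intervalIntegral.integral_const_mul,
    ← intervalIntegral.integral_sub (i1.const_mul 2) i2]
  refine intervalIntegral.integral_mono_on hxy ((i1.const_mul 2).sub i2) i3 fun t _ => ?_
  -- The two integrands differ by exactly `(g - φ')² + V (u - φ)²`.
  nlinarith [sq_nonneg (g t - p t * φ t), mul_nonneg (hV0 t) (sq_nonneg (u t - φ t))]

/-! ### The minimiser and the sup-norm constraint. -/

/-- The solution decaying at both ends, with a corner at `a`. -/
def peak (ψ φ : ℝ → ℝ) (a x : ℝ) : ℝ := if x ≤ a then ψ x / ψ a else φ x / φ a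

/-- The derivative of `peak`. -/
def peakDeriv (q p ψ φ : ℝ → ℝ) (a x : ℝ) : ℝ :=
  if x < a then q x * (ψ x / ψ a) else p x * (φ x / φ a)

lemma peak_self (h : ψ a ≠ 0) : peak ψ φ a a = 1 := by simp [peak, div_self h]

lemma peak_of_le {x : ℝ} (h : x ≤ a) : peak ψ φ a x = ψ x / ψ a := if_pos h

lemma peak_of_ge {x : ℝ} (hψ : ψ a ≠ 0) (hφ : φ a ≠ 0) (h : a ≤ x) :
    peak ψ φ a x = φ x / φ a := by
  rcases h.eq_or_lt with rfl | h
  · rw [peak_self hψ, div_self hφ]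
  · exact if_neg (not_le.2 h)

lemma continuous_peak (hψ0 : ψ a ≠ 0) (hφ0 : φ a ≠ 0) (hψ : Continuous ψ) (hφ : Continuous φ) :
    Continuous (peak ψ φ a) := by
  refine Continuous.if_le (by fun_prop) (by fun_prop) continuous_id continuous_const ?_
  rintro x rfl
  rw [div_self hψ0, div_self hφ0]

/-- The corner at `a` does no harm because right derivatives suffice; the strict inequality in
`peakDeriv` selects the right one there. -/
lemma isPrimitive_peak (hψ0 : ψ a ≠ 0) (hφ0 : φ a ≠ 0)
    (hψ : ∀ x, HasDerivAt ψ (q x * ψ x) x) (hφ : ∀ x, HasDerivAt φ (p x * φ x) x)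
    (hq : Continuous q) (hp : Continuous p) :
    IsPrimitive (peak ψ φ a) (peakDeriv q p ψ φ a) := by
  have cψ : Continuous ψ := continuous_iff_continuousAt.2 fun x => (hψ x).continuousAt
  have cφ : Continuous φ := continuous_iff_continuousAt.2 fun x => (hφ x).continuousAt
  refine isPrimitive_of_hasDerivWithinAt_Ioi (continuous_peak hψ0 hφ0 cψ cφ) ?_ fun x => ?_
  · have h1 : Continuous fun x => q x * (ψ x / ψ a) := by fun_prop
    have h2 : Continuous fun x => p x * (φ x / φ a) := by fun_prop
    have : peakDeriv q p ψ φ a = fun x => (Iio a).indicator (fun x => q x * (ψ x / ψ a)) x +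
        (Ici a).indicator (fun x => p x * (φ x / φ a)) x := by
      ext x
      rcases lt_or_ge x a with h | h
      · simp [peakDeriv, h, not_le.2 h]
      · simp [peakDeriv, h, not_lt.2 h]
    rw [this]
    exact (h1.locallyIntegrable.indicator measurableSet_Iio).add
      (h2.locallyIntegrable.indicator measurableSet_Ici)
  · rcases lt_or_ge x a with h | h
    · have h1 : HasDerivAt (fun x => ψ x / ψ a) (peakDeriv q p ψ φ a x) x :=
        ((hψ x).div_const _).congr_deriv (by simp [peakDeriv, h]; ring)
      refine (h1.congr_of_eventuallyEq ?_).hasDerivWithinAt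
      filter_upwards [Iio_mem_nhds h] with y hy using peak_of_le (le_of_lt hy)
    · have h1 : HasDerivAt (fun x => φ x / φ a) (peakDeriv q p ψ φ a x) x :=
        ((hφ x).div_const _).congr_deriv (by simp [peakDeriv, not_lt.2 h]; ring)
      exact h1.hasDerivWithinAt.congr (fun y hy => peak_of_ge hψ0 hφ0 (h.trans (le_of_lt hy)))
        (peak_of_ge hψ0 hφ0 h)

lemma eLpNorm_top_eq_one {u : ℝ → ℝ} (hu : Continuous u) (h1 : ∀ x, |u x| ≤ 1) (ha : u a = 1) :
    eLpNorm u ⊤ volume = 1 := by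
  refine le_antisymm ?_ ?_
  · rw [eLpNorm_exponent_top]
    refine eLpNormEssSup_le_of_ae_bound (C := 1) (Eventually.of_forall h1) |>.trans ?_
    simp
  · rw [eLpNorm_exponent_top]
    -- An essential bound `c < 1` would hold on a dense set, hence everywhere by continuity, against
    -- `u a = 1`.
    by_contra! hlt
    obtain ⟨c, hc1, hc2⟩ := ENNReal.lt_iff_exists_nnreal_btwn.1 hlt
    have hae : ∀ᵐ x, |u x| ≤ c := by
      filter_upwards [ae_le_eLpNormEssSup (f := u) (μ := volume)] with x hx
      have := hx.trans hc1.le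
      rw [enorm_le_coe] at this
      simpa using NNReal.coe_le_coe.2 this
    have hall := (Measure.dense_of_ae hae).closure_eq
    have hcl : IsClosed {x | |u x| ≤ (c : ℝ)} := isClosed_le hu.abs continuous_const
    rw [hcl.closure_eq] at hall
    have := (hall ▸ mem_univ a : a ∈ {x | |u x| ≤ (c : ℝ)})
    rw [mem_ofPred_eq, ha, abs_one] at this
    have h2 : (c : ℝ) < 1 := by exact_mod_cast hc2
    linarith

lemma abs_le_one_of_eLpNorm_top {u : ℝ → ℝ} (hu : Continuous u) (h : eLpNorm u ⊤ volume = 1)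
    (x : ℝ) : |u x| ≤ 1 := by
  have hae : ∀ᵐ x, |u x| ≤ 1 := by
    rw [eLpNorm_exponent_top] at h
    filter_upwards [ae_le_eLpNormEssSup (f := u) (μ := volume)] with x hx
    rw [h, show (1 : ENNReal) = ((1 : NNReal) : ENNReal) by simp, enorm_le_coe] at hx
    simpa using NNReal.coe_le_coe.2 hx
  have hcl : IsClosed {x | |u x| ≤ 1} := isClosed_le hu.abs continuous_const
  have hall := (Measure.dense_of_ae hae).closure_eq
  rw [hcl.closure_eq] at hall
  exact (hall ▸ mem_univ x : x ∈ {x | |u x| ≤ 1})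

lemma IsPrimitive.energy_eq {u g : ℝ → ℝ} (h : IsPrimitive u g) :
    energy V u = ∫ x, (g x ^ 2 + V x * u x ^ 2) :=
  integral_congr_ae (by filter_upwards [h.hasWeakDeriv.weakDeriv_ae_eq] with x hx; rw [hx])

/-! ### The pair of decaying solutions: `F`, `ℓ±`, `h±` and `H±` in terms of `p` and `q`. -/

/-- Hypotheses on logarithmic derivatives `p`, `q` of positive solutions `φ`, `ψ` of `u'' = V u`
decaying at `+∞` and `-∞` respectively. -/
structure DecayingPair (V p q φ ψ : ℝ → ℝ) (m M : ℝ) : Prop where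
  contV : Continuous V
  m_pos : 0 < m
  M_pos : 0 < M
  sq_le : ∀ x, m ^ 2 ≤ V x
  hp : ∀ x, HasDerivAt p (V x - p x ^ 2) x
  hq : ∀ x, HasDerivAt q (V x - q x ^ 2) x
  hφ : ∀ x, HasDerivAt φ (p x * φ x) x
  hψ : ∀ x, HasDerivAt ψ (q x * ψ x) x
  φ_pos : ∀ x, 0 < φ x
  ψ_pos : ∀ x, 0 < ψ x
  φ_zero : φ 0 = 1
  ψ_zero : ψ 0 = 1
  p_mem : ∀ x, -M ≤ p x ∧ p x ≤ -m
  q_mem : ∀ x, m ≤ q x ∧ q x ≤ M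
  φ_lim : Tendsto φ atTop (𝓝 0)
  ψ_lim : Tendsto ψ atBot (𝓝 0)

namespace DecayingPair

variable {m : ℝ}

section
variable (D : DecayingPair V p q φ ψ m M)
include D

lemma V_nonneg (x : ℝ) : 0 ≤ V x := (sq_nonneg m).trans (D.sq_le x)

lemma abs_p_le (x : ℝ) : |p x| ≤ M :=
  abs_le.2 ⟨(D.p_mem x).1, by linarith [(D.p_mem x).2, D.m_pos, D.M_pos]⟩

lemma abs_q_le (x : ℝ) : |q x| ≤ M :=
  abs_le.2 ⟨by linarith [(D.q_mem x).1, D.m_pos, D.M_pos], (D.q_mem x).2⟩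

end

end DecayingPair

end

namespace DecayingPair

variable {V p q φ ψ : ℝ → ℝ} {m M : ℝ}

section
variable (D : DecayingPair V p q φ ψ m M)
include D

lemma continuous_p : Continuous p := continuous_iff_continuousAt.2 fun x => (D.hp x).continuousAt
lemma continuous_q : Continuous q := continuous_iff_continuousAt.2 fun x => (D.hq x).continuousAt

lemma antitone_φ : Antitone φ :=
  antitone_of_deriv_nonpos (fun x => (D.hφ x).differentiableAt) fun x => by
    rw [(D.hφ x).deriv]
    exact mul_nonpos_of_nonpos_of_nonneg (by linarith [(D.p_mem x).2, D.m_pos]) (D.φ_pos x).le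

lemma monotone_ψ : Monotone ψ :=
  monotone_of_deriv_nonneg (fun x => (D.hψ x).differentiableAt) fun x => by
    rw [(D.hψ x).deriv]
    exact mul_nonneg (by linarith [(D.q_mem x).1, D.m_pos]) (D.ψ_pos x).le

lemma hφ_normalized (a x : ℝ) : HasDerivAt (fun x => φ x / φ a) (p x * (φ x / φ a)) x :=
  ((D.hφ x).div_const _).congr_deriv (by ring)

lemma hψ_normalized (a x : ℝ) : HasDerivAt (fun x => ψ x / ψ a) (q x * (ψ x / ψ a)) x :=
  ((D.hψ x).div_const _).congr_deriv (by ring)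

lemma φ_normalized_lim (a : ℝ) : Tendsto (fun x => φ x / φ a) atTop (𝓝 0) := by
  simpa using D.φ_lim.div_const (φ a)

lemma ψ_normalized_lim (a : ℝ) : Tendsto (fun x => ψ x / ψ a) atBot (𝓝 0) := by
  simpa using D.ψ_lim.div_const (ψ a)

lemma isPrimitive_peak (a : ℝ) : IsPrimitive (peak ψ φ a) (peakDeriv q p ψ φ a) :=
  SobolevBest.isPrimitive_peak (D.ψ_pos a).ne' (D.φ_pos a).ne' D.hψ D.hφ D.continuous_q
    D.continuous_p

lemma integral_peak (a : ℝ) :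
    Integrable (fun x => peakDeriv q p ψ φ a x ^ 2 + V x * peak ψ φ a x ^ 2) ∧
      ∫ x, (peakDeriv q p ψ φ a x ^ 2 + V x * peak ψ φ a x ^ 2) = q a - p a := by
  obtain ⟨i1, e1⟩ := energy_Ioi D.hp (D.hφ_normalized a) D.abs_p_le D.V_nonneg
    (D.φ_normalized_lim a) a
  obtain ⟨i2, e2⟩ := energy_Iic D.hq (D.hψ_normalized a) D.abs_q_le D.V_nonneg
    (D.ψ_normalized_lim a) a
  rw [div_self (D.φ_pos a).ne', mul_one, mul_one, ← integral_Ici_eq_integral_Ioi] at e1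
  rw [div_self (D.ψ_pos a).ne', mul_one, mul_one, integral_Iic_eq_integral_Iio] at e2
  rw [← integrableOn_Ici_iff_integrableOn_Ioi] at i1
  rw [integrableOn_Iic_iff_integrableOn_Iio] at i2
  have c1 : EqOn (fun x => (p x * (φ x / φ a)) ^ 2 + V x * (φ x / φ a) ^ 2)
      (fun x => peakDeriv q p ψ φ a x ^ 2 + V x * peak ψ φ a x ^ 2) (Ici a) := fun x hx => by
    simp only [peakDeriv, if_neg (not_lt.2 (mem_Ici.1 hx)),
      peak_of_ge (D.ψ_pos a).ne' (D.φ_pos a).ne' (mem_Ici.1 hx)]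
  have c2 : EqOn (fun x => (q x * (ψ x / ψ a)) ^ 2 + V x * (ψ x / ψ a) ^ 2)
      (fun x => peakDeriv q p ψ φ a x ^ 2 + V x * peak ψ φ a x ^ 2) (Iio a) := fun x hx => by
    simp only [peakDeriv, if_pos (mem_Iio.1 hx), peak_of_le (le_of_lt (mem_Iio.1 hx))]
  have j1 := i1.congr_fun c1 measurableSet_Ici
  have j2 := i2.congr_fun c2 measurableSet_Iio
  rw [setIntegral_congr_fun measurableSet_Ici c1] at e1
  rw [setIntegral_congr_fun measurableSet_Iio c2] at e2
  have hi : Integrable (fun x => peakDeriv q p ψ φ a x ^ 2 + V x * peak ψ φ a x ^ 2) := by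
    rw [← integrableOn_univ, ← Iio_union_Ici (a := a)]
    exact j2.union j1
  refine ⟨hi, ?_⟩
  rw [← integral_add_compl measurableSet_Iio hi, compl_Iio, e1, e2, sub_eq_add_neg]

lemma peak_mem_K (a : ℝ) : peak ψ φ a ∈ K a := by
  have hP := D.isPrimitive_peak a
  have hi := (D.integral_peak a).1
  have hm2 : 0 < m ^ 2 := pow_pos D.m_pos 2
  have cP := hP.continuous
  refine ⟨⟨cP, ?_, peakDeriv q p ψ φ a, ?_, hP.hasWeakDeriv⟩, peak_self (D.ψ_pos a).ne',
    eLpNorm_top_eq_one cP (fun x => ?_) (peak_self (D.ψ_pos a).ne')⟩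
  · rw [memLp_two_iff_integrable_sq cP.aestronglyMeasurable]
    refine (hi.const_mul (m ^ 2)⁻¹).mono' (cP.pow 2).aestronglyMeasurable
      (Eventually.of_forall fun x => ?_)
    rw [Real.norm_eq_abs, abs_of_nonneg (sq_nonneg _), inv_mul_eq_div, le_div_iff₀ hm2]
    nlinarith [sq_nonneg (peakDeriv q p ψ φ a x),
      mul_le_mul_of_nonneg_right (D.sq_le x) (sq_nonneg (peak ψ φ a x))]
  · have hmeas := hP.1.aestronglyMeasurable
    rw [memLp_two_iff_integrable_sq hmeas]
    refine hi.mono' (hmeas.pow 2) (Eventually.of_forall fun x => ?_)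
    rw [Real.norm_eq_abs, abs_of_nonneg (sq_nonneg _)]
    nlinarith [mul_nonneg (D.V_nonneg x) (sq_nonneg (peak ψ φ a x))]
  · rcases le_total x a with h | h
    · rw [peak_of_le h, abs_of_nonneg (div_nonneg (D.ψ_pos x).le (D.ψ_pos a).le),
        div_le_one (D.ψ_pos a)]
      exact D.monotone_ψ h
    · rw [peak_of_ge (D.ψ_pos a).ne' (D.φ_pos a).ne' h,
        abs_of_nonneg (div_nonneg (D.φ_pos x).le (D.φ_pos a).le), div_le_one (D.φ_pos a)]
      exact D.antitone_φ h

lemma energy_peak (a : ℝ) : energy V (peak ψ φ a) = q a - p a := by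
  rw [(D.isPrimitive_peak a).energy_eq, (D.integral_peak a).2]

/-- Compare `u` with the normalised solutions on each side of `a`. The outer boundary terms vanish
in the limit because `|u| ≤ 1` and the solutions decay; `u a = 1` leaves `-p a` on the right and `q
a` on the left. -/
lemma energy_ge {B : ℝ} (hB : ∀ x, V x ≤ B) {a : ℝ} {u : ℝ → ℝ} (hu : u ∈ K a) :
    q a - p a ≤ energy V u := by
  obtain ⟨⟨cu, u2, g, g2, hw⟩, hua, hsup⟩ := hu
  have hP := hw.isPrimitive cu
  have hu1 := abs_le_one_of_eLpNorm_top cu hsup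
  rw [hP.energy_eq]
  have ig : Integrable fun x => g x ^ 2 := g2.integrable_sq
  have iu : Integrable fun x => V x * u x ^ 2 :=
    u2.integrable_sq.bdd_mul (c := B) D.contV.aestronglyMeasurable
      (Eventually.of_forall fun x => by
        rw [Real.norm_eq_abs, abs_of_nonneg (D.V_nonneg x)]; exact hB x)
  have hi : Integrable fun x => g x ^ 2 + V x * u x ^ 2 := ig.add iu
  have key : ∀ {b f : ℝ → ℝ} {l : Filter ℝ}, (∀ x, |b x| ≤ M) → Tendsto f l (𝓝 0) →
      Tendsto (fun x => 2 * (b x * f x * u x) - b x * f x * f x) l (𝓝 0) := by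
    intro b f l hb hf
    have h1 := tendsto_bdd_mul_zero hb hf
    have h2 := tendsto_bdd_mul_zero hu1 h1
    have h3 := (h2.const_mul 2).sub (h1.mul hf)
    simp only [mul_zero, sub_zero] at h3
    exact h3.congr fun x => by ring
  have top : -p a ≤ ∫ x in Ioi a, (g x ^ 2 + V x * u x ^ 2) := by
    have hl := intervalIntegral_tendsto_integral_Ioi a hi.integrableOn tendsto_id
    have hk := (key D.abs_p_le (D.φ_normalized_lim a)).sub_const (p a)
    rw [zero_sub] at hk
    refine le_of_tendsto_of_tendsto hk hl ?_
    filter_upwards [eventually_ge_atTop a] with y hy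
    have := energy_interval_ge D.contV D.V_nonneg D.hp (D.hφ_normalized a) hP ig hy
    rw [div_self (D.φ_pos a).ne', hua] at this
    simp only [id]
    linarith
  have bot : q a ≤ ∫ x in Iic a, (g x ^ 2 + V x * u x ^ 2) := by
    have hl := intervalIntegral_tendsto_integral_Iic a hi.integrableOn tendsto_id
    have hk := (key D.abs_q_le (D.ψ_normalized_lim a)).const_sub (q a)
    rw [sub_zero] at hk
    refine le_of_tendsto_of_tendsto hk hl ?_
    filter_upwards [eventually_le_atBot a] with y hy
    have := energy_interval_ge D.contV D.V_nonneg D.hq (D.hψ_normalized a) hP ig hy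
    rw [div_self (D.ψ_pos a).ne', hua] at this
    simp only [id]
    linarith
  rw [← integral_add_compl measurableSet_Iic hi, compl_Iic]
  linarith

lemma F_eq {B : ℝ} (hB : ∀ x, V x ≤ B) : F V = fun a => q a - p a := by
  ext a
  refine IsLeast.csInf_eq ⟨⟨_, D.peak_mem_K a, D.energy_peak a⟩, ?_⟩
  rintro _ ⟨u, hu, rfl⟩
  exact D.energy_ge hB hu

lemma isDecayingSolution_φ : IsDecayingSolution V atTop φ :=
  (isClassicalSolution_of_logDeriv D.hp D.hφ).isDecayingSolution D.contV D.φ_zero D.φ_lim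

lemma isDecayingSolution_ψ : IsDecayingSolution V atBot ψ :=
  (isClassicalSolution_of_logDeriv D.hq D.hψ).isDecayingSolution D.contV D.ψ_zero D.ψ_lim

lemma eq_φ {χ : ℝ → ℝ} (h : IsDecayingSolution V atTop χ) : χ = φ := by
  obtain ⟨d, hd⟩ := h.exists_isClassicalSolution D.contV
  exact eq_of_tendsto_atTop D.M_pos D.hp D.hφ D.φ_pos (fun x => (D.p_mem x).1) D.φ_lim hd
    h.2.2.2.2 (h.2.2.2.1.trans D.φ_zero.symm)

lemma eq_ψ {χ : ℝ → ℝ} (h : IsDecayingSolution V atBot χ) : χ = ψ := by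
  obtain ⟨d, hd⟩ := h.exists_isClassicalSolution D.contV
  exact eq_of_tendsto_atBot D.M_pos D.hq D.hψ D.ψ_pos (fun x => (D.q_mem x).2) D.ψ_lim hd
    h.2.2.2.2 (h.2.2.2.1.trans D.ψ_zero.symm)

lemma phiPlus_eq : phiPlus V = φ := decayingSolution_eq D.isDecayingSolution_φ fun _ => D.eq_φ

lemma phiMinus_eq : phiMinus V = ψ := decayingSolution_eq D.isDecayingSolution_ψ fun _ => D.eq_ψ

lemma hasDerivAt_ellPlus (x : ℝ) : HasDerivAt (ellPlus V) (p x) x := by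
  have : ellPlus V = fun x => Real.log (φ x) := by ext; rw [ellPlus, D.phiPlus_eq]
  rw [this]
  have hne := (D.φ_pos x).ne'
  exact ((D.hφ x).log hne).congr_deriv (by field_simp)

lemma hasDerivAt_ellMinus (x : ℝ) : HasDerivAt (ellMinus V) (q x) x := by
  have : ellMinus V = fun x => Real.log (ψ x) := by ext; rw [ellMinus, D.phiMinus_eq]
  rw [this]
  have hne := (D.ψ_pos x).ne'
  exact ((D.hψ x).log hne).congr_deriv (by field_simp)

lemma hasDerivAt_hPlus (x : ℝ) : HasDerivAt (hPlus V) (2 * p x * φ x ^ 2) x := by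
  have : hPlus V = fun x => φ x ^ 2 := by ext; rw [hPlus, D.phiPlus_eq]
  rw [this]
  exact ((D.hφ x).pow 2).congr_deriv (by simp; ring)

lemma hasDerivAt_hMinus (x : ℝ) : HasDerivAt (hMinus V) (2 * q x * ψ x ^ 2) x := by
  have : hMinus V = fun x => ψ x ^ 2 := by ext; rw [hMinus, D.phiMinus_eq]
  rw [this]
  exact ((D.hψ x).pow 2).congr_deriv (by simp; ring)

lemma q_sub_p_pos (x : ℝ) : 0 < q x - p x := by
  linarith [(D.q_mem x).1, (D.p_mem x).2, D.m_pos]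

lemma wronskian (x : ℝ) : (q x - p x) * (ψ x * φ x) = q 0 - p 0 := by
  have := wronskian_eq (isClassicalSolution_of_logDeriv D.hq D.hψ)
    (isClassicalSolution_of_logDeriv D.hp D.hφ) x 0
  rw [D.φ_zero, D.ψ_zero] at this
  linarith

/-- By the Wronskian identity `(ψ/φ)' = (q 0 - p 0)/φ²`, so `1/h₊` has an explicit primitive; it
vanishes at `-∞` because `ψ → 0` while `φ ≥ 1` on the negative axis. -/
lemma integral_hPlus (x : ℝ) : IntegrableOn (fun ξ => 1 / hPlus V ξ) (Iic x) ∧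
    HPlus V x = ψ x / φ x / (q 0 - p 0) := by
  have hW := D.q_sub_p_pos 0
  have he : (fun ξ => 1 / hPlus V ξ) = fun ξ => 1 / φ ξ ^ 2 := by
    ext; rw [hPlus, D.phiPlus_eq]
  have hd : ∀ x, HasDerivAt (fun x => ψ x / φ x / (q 0 - p 0)) (1 / φ x ^ 2) x := fun x => by
    have hne := (D.φ_pos x).ne'
    refine (((D.hψ x).div (D.hφ x) hne).div_const _).congr_deriv ?_
    field_simp
    linarith [D.wronskian x]
  have hl : Tendsto (fun x => ψ x / φ x / (q 0 - p 0)) atBot (𝓝 0) := by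
    refine squeeze_zero' (g := fun x => ψ x / (q 0 - p 0)) (Eventually.of_forall fun x =>
      div_nonneg (div_nonneg (D.ψ_pos x).le (D.φ_pos x).le) hW.le) ?_
      (by simpa using D.ψ_lim.div_const (q 0 - p 0))
    filter_upwards [eventually_le_atBot 0] with x hx
    have h1 : 1 ≤ φ x := D.φ_zero ▸ D.antitone_φ hx
    exact div_le_div_of_nonneg_right (div_le_self (D.ψ_pos x).le h1) hW.le
  have hi := integrableOn_Iic_deriv_of_nonneg hd (fun x => by positivity) hl x
  rw [he]
  refine ⟨hi, ?_⟩
  rw [HPlus, he, integral_Iic_of_hasDerivAt_of_tendsto' (fun x _ => hd x) hi hl, sub_zero]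

lemma integral_hMinus (x : ℝ) : IntegrableOn (fun ξ => 1 / hMinus V ξ) (Ioi x) ∧
    HMinus V x = φ x / ψ x / (q 0 - p 0) := by
  have hW := D.q_sub_p_pos 0
  have he : (fun ξ => 1 / hMinus V ξ) = fun ξ => 1 / ψ ξ ^ 2 := by
    ext; rw [hMinus, D.phiMinus_eq]
  have hd : ∀ x, HasDerivAt (fun x => -(φ x / ψ x / (q 0 - p 0))) (1 / ψ x ^ 2) x := fun x => by
    have hne := (D.ψ_pos x).ne'
    refine (((D.hφ x).div (D.hψ x) hne).div_const _).neg.congr_deriv ?_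
    field_simp
    linarith [D.wronskian x]
  have hl : Tendsto (fun x => -(φ x / ψ x / (q 0 - p 0))) atTop (𝓝 0) := by
    suffices h : Tendsto (fun x => φ x / ψ x / (q 0 - p 0)) atTop (𝓝 0) by simpa using h.neg
    refine squeeze_zero' (g := fun x => φ x / (q 0 - p 0)) (Eventually.of_forall fun x =>
      div_nonneg (div_nonneg (D.φ_pos x).le (D.ψ_pos x).le) hW.le) ?_
      (by simpa using D.φ_lim.div_const (q 0 - p 0))
    filter_upwards [eventually_ge_atTop 0] with x hx
    have h1 : 1 ≤ ψ x := D.ψ_zero ▸ D.monotone_ψ hx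
    exact div_le_div_of_nonneg_right (div_le_self (D.φ_pos x).le h1) hW.le
  have hi := integrableOn_Ioi_deriv_of_nonneg' (a := x) (fun x _ => hd x)
    (fun x _ => by positivity) hl
  rw [he]
  refine ⟨hi, ?_⟩
  rw [HMinus, he, integral_Ioi_of_hasDerivAt_of_tendsto' (fun x _ => hd x) hi hl]
  ring

end

end DecayingPair

/-! ### Existence of the pair and the three equivalences. -/

lemma exists_decayingPair {V : ℝ → ℝ} (hV : Continuous V) {m M : ℝ} (hm : 0 < m)
    (hmV : ∀ x, m ^ 2 ≤ V x) (hVM : ∀ x, V x ≤ M ^ 2) (hM : 0 < M) :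
    ∃ p q φ ψ : ℝ → ℝ, DecayingPair V p q φ ψ m M := by
  obtain ⟨q, hq, q_mem⟩ := exists_riccati hV hm hmV hVM hM
  obtain ⟨p, hp, p_mem⟩ := exists_riccati_neg hV hm hmV hVM hM
  obtain ⟨φ, hφ, φ_pos, φ_zero⟩ :=
    exists_logDeriv (continuous_iff_continuousAt.2 fun x => (hp x).continuousAt)
  obtain ⟨ψ, hψ, ψ_pos, ψ_zero⟩ :=
    exists_logDeriv (continuous_iff_continuousAt.2 fun x => (hq x).continuousAt)
  exact ⟨p, q, φ, ψ, hV, hm, hM, hmV, hp, hq, hφ, hψ, φ_pos, ψ_pos, φ_zero, ψ_zero, p_mem, q_mem,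
    tendsto_atTop_zero_of_logDeriv_le hm hφ φ_pos fun x => (p_mem x).2,
    tendsto_atBot_zero_of_le_logDeriv hm hψ ψ_pos fun x => (q_mem x).1⟩

lemma contDiff_two_of_hasDerivAt {f f' f'' : ℝ → ℝ} (h : ∀ x, HasDerivAt f (f' x) x)
    (h' : ∀ x, HasDerivAt f' (f'' x) x) (hc : Continuous f'') : ContDiff ℝ 2 f := by
  have e : deriv f = f' := funext fun x => (h x).deriv
  have e' : deriv f' = f'' := funext fun x => (h' x).deriv
  rw [show (2 : WithTop ℕ∞) = 1 + 1 by norm_num, contDiff_succ_iff_deriv, e,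
    contDiff_one_iff_deriv, e']
  exact ⟨fun x => (h x).differentiableAt, by simp, fun x => (h' x).differentiableAt, hc⟩

lemma forall_of_ae_bounds {V : ℝ → ℝ} {v₀ v₁ : ℝ} (hV : Continuous V)
    (h : ∀ᵐ x, v₀ ≤ V x ∧ V x ≤ v₁) (x : ℝ) : v₀ ≤ V x ∧ V x ≤ v₁ := by
  have hcl : IsClosed {x | v₀ ≤ V x ∧ V x ≤ v₁} :=
    (isClosed_le continuous_const hV).inter (isClosed_le hV continuous_const)
  have hall := (Measure.dense_of_ae h).closure_eq
  rw [hcl.closure_eq] at hall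
  exact (hall ▸ mem_univ x : x ∈ {x | v₀ ≤ V x ∧ V x ≤ v₁})

end SobolevBest

end

open MeasureTheory SobolevBest in
theorem mainTheorem1 (V : ℝ → ℝ) (v₀ v₁ : ℝ) (hv₀ : 0 < v₀)
    (hbdd : ∀ᵐ x ∂(MeasureTheory.volume : MeasureTheory.Measure ℝ), v₀ ≤ V x ∧ V x ≤ v₁)
    (hV : Continuous V) :
    SobolevBest.WellDefined V ∧
    ∀ a : ℝ,
      (SobolevBest.LocalMinCondition V a ↔
        (-deriv (SobolevBest.ellPlus V) a = deriv (SobolevBest.ellMinus V) a ∧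
          deriv (SobolevBest.ellMinus V) a ≥ Real.sqrt (V a))) ∧
      (SobolevBest.LocalMinCondition V a ↔
        (deriv (SobolevBest.hPlus V) a * SobolevBest.HPlus V a = -1 ∧
          deriv (deriv (SobolevBest.ellPlus V)) a ≤ 0)) ∧
      (SobolevBest.LocalMinCondition V a ↔
        (deriv (SobolevBest.hMinus V) a * SobolevBest.HMinus V a = 1 ∧
          deriv (deriv (SobolevBest.ellMinus V)) a ≤ 0)) := by
  have hb := forall_of_ae_bounds hV hbdd
  have hv₁ : 0 < v₁ := hv₀.trans_le ((hb 0).1.trans (hb 0).2)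
  obtain ⟨p, q, φ, ψ, D⟩ := exists_decayingPair hV (m := Real.sqrt v₀) (M := Real.sqrt v₁)
    (Real.sqrt_pos.2 hv₀) (fun x => by rw [Real.sq_sqrt hv₀.le]; exact (hb x).1)
    (fun x => by rw [Real.sq_sqrt hv₁.le]; exact (hb x).2) (Real.sqrt_pos.2 hv₁)
  have cp := D.continuous_p
  have cq := D.continuous_q
  have hF := D.F_eq fun x => (hb x).2
  have hF1 : ∀ x, HasDerivAt (F V) (p x ^ 2 - q x ^ 2) x := fun x => by
    rw [hF]
    exact ((D.hq x).sub (D.hp x)).congr_deriv (by ring)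
  -- In `F' = p² - q²` the potential has cancelled, which is why `F` is `C²` for merely continuous
  -- `V`.
  have hF2 : ∀ x, HasDerivAt (fun x => p x ^ 2 - q x ^ 2)
      (2 * p x * (V x - p x ^ 2) - 2 * q x * (V x - q x ^ 2)) x := fun x =>
    (((D.hp x).pow 2).sub ((D.hq x).pow 2)).congr_deriv (by simp)
  have dF : deriv (F V) = fun x => p x ^ 2 - q x ^ 2 := funext fun x => (hF1 x).deriv
  have dP : deriv (ellPlus V) = p := funext fun x => (D.hasDerivAt_ellPlus x).deriv
  have dM : deriv (ellMinus V) = q := funext fun x => (D.hasDerivAt_ellMinus x).deriv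
  refine ⟨⟨⟨φ, D.isDecayingSolution_φ, fun _ => D.eq_φ⟩, ⟨ψ, D.isDecayingSolution_ψ, fun _ => D.eq_ψ⟩,
    fun x => D.phiPlus_eq ▸ D.φ_pos x, fun x => D.phiMinus_eq ▸ D.ψ_pos x,
    contDiff_two_of_hasDerivAt hF1 hF2 (by fun_prop),
    contDiff_two_of_hasDerivAt D.hasDerivAt_ellPlus D.hp (by fun_prop),
    contDiff_two_of_hasDerivAt D.hasDerivAt_ellMinus D.hq (by fun_prop),
    fun x => (D.integral_hPlus x).1, fun x => (D.integral_hMinus x).1⟩, fun a => ?_⟩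
  have hq0 : 0 < q a := D.m_pos.trans_le (D.q_mem a).1
  have hp0 : p a < 0 := by linarith [(D.p_mem a).2, D.m_pos]
  have hmin : LocalMinCondition V a ↔ -p a = q a ∧ V a ≤ q a ^ 2 := by
    rw [LocalMinCondition, dF, (hF2 a).deriv]
    have h1 : p a ^ 2 - q a ^ 2 = 0 ↔ -p a = q a := by
      constructor
      · intro h
        have : (p a - q a) * (p a + q a) = 0 := by linarith
        rcases mul_eq_zero.1 this with h | h <;> linarith
      · intro h; rw [← h]; ring
    rw [h1]
    refine and_congr_right fun h => ?_
    have e : 2 * p a * (V a - p a ^ 2) - 2 * q a * (V a - q a ^ 2) =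
        4 * q a * (q a ^ 2 - V a) := by
      rw [show p a = -q a by linarith]; ring
    rw [e, mul_nonneg_iff_of_pos_left (by positivity), sub_nonneg]
  have hW := D.wronskian a
  have hqp := (D.q_sub_p_pos a).ne'
  have hφ0 := (D.φ_pos a).ne'
  have hψ0 := (D.ψ_pos a).ne'
  rw [hmin, dP, dM, (D.hp a).deriv, (D.hq a).deriv, (D.hasDerivAt_hPlus a).deriv,
    (D.hasDerivAt_hMinus a).deriv, (D.integral_hPlus a).2, (D.integral_hMinus a).2, ← hW]
  -- With the Wronskian evaluated at `a` the values of `φ` and `ψ` cancel; the quotients equal `-1`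
  -- and `1` respectively exactly when `p a = -q a`.
  have eP : 2 * p a * φ a ^ 2 * (ψ a / φ a / ((q a - p a) * (ψ a * φ a))) =
      2 * p a / (q a - p a) := by field_simp
  have eM : 2 * q a * ψ a ^ 2 * (φ a / ψ a / ((q a - p a) * (ψ a * φ a))) =
      2 * q a / (q a - p a) := by field_simp
  rw [eP, eM, div_eq_iff hqp, div_eq_iff hqp, ge_iff_le, Real.sqrt_le_left hq0.le]
  refine ⟨Iff.rfl, ?_, ?_⟩
  · constructor
    · rintro ⟨h1, h2⟩
      exact ⟨by linarith, by rw [← h1, neg_sq] at h2; linarith⟩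
    · rintro ⟨h1, h2⟩
      have h3 : -p a = q a := by linarith
      exact ⟨h3, by rw [← h3, neg_sq]; linarith⟩
  · constructor
    · rintro ⟨h1, h2⟩
      exact ⟨by linarith, by linarith⟩
    · rintro ⟨h1, h2⟩
      exact ⟨by linarith, by linarith⟩
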